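/- Conventions. A Sylow $p$-subgroup of a group is a maximal $p$-subgroup. A linear group is a group isomorphic to a subgroup of $\mathrm{GL}_n(K)$ for some $n$ and some field $K$. A pseudofinite group (respectively field) is an infinite model of the common first-order theory of all finite groups (respectively finite fields). For a field $K$, consider the conditions - $(V_1)$ $-1$ is a sum of two squares in $K$; - $(V_2)$ $K$ has no element of multiplicative order $4$; - $(V_3)$ every $a+bi\in K(i)$ with $a,b\in K$ and $i^2=-1$ whose multiplicative order is a power of $2$ satisfies $(a+bi)(a-bi)=1$. Statement. For every $N\ge 0$ there are infinitely many primes $p\equiv 3\pmod 4$ with $2^N\mid p+1$; consequently there is an infinite set $J$ of primes congruent to $3$ modulo $4$ such that, for every $N$, $2^N$ divides $p+1$ for all but finitely many $p\in J$. For every such $J$ and every non-principal ultrafilter $\mathcal U$ on $J$, let $F=\prod_{p\in J}\mathbb F_p/\mathcal U$. Then $F$ is a pseudofinite field satisfying $(V_1)$, $(V_2)$ and $(V_3)$, and $\mathrm{GL}_2(F)$ is a linear pseudofinite group having two Sylow $2$-subgroups that are not conjugate. Consequently, the class $\mathfrak S$ of groups in which, for each prime $p$, any two Sylow $p$-subgroups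 are conjugate is not closed under ultraproducts, and it is not elementary, that is, there is no first-order theory in the language of groups whose models among groups are exactly the members of $\mathfrak S$. -/

import Mathlib

open scoped MatrixGroups

noncomputable section

namespace SylowUltra

/-! ### Ultraproducts of groups and of fields

The underlying set is Mathlib's `Filter.Product`, the product of the family modulo equality on a
set of the ultrafilter; the operations are computed coordinatewise on representatives. -/

section Ultraproducts

variable {ι : Type*} {U : Ultrafilter ι} {M : ι → Type*}

/-- The class of a family in the ultraproduct. -/
def mk (U : Ultrafilter ι) (x : ∀ i, M i) : (U : Filter ι).Product M :=
  Quotient.mk ((U : Filter ι).productSetoid M) x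

theorem mk_surjective : Function.Surjective (mk U : (∀ i, M i) → (U : Filter ι).Product M) :=
  fun q => Quotient.exists_rep q

theorem mk_eq_mk {x y : ∀ i, M i} : mk U x = mk U y ↔ ∀ᶠ i in (U : Filter ι), x i = y i :=
  Quotient.eq (r := (U : Filter ι).productSetoid M)

/-- The coordinatewise extension of a family of unary operations. -/
def map (f : ∀ i, M i → M i) : (U : Filter ι).Product M → (U : Filter ι).Product M :=
  Quotient.map (fun x i => f i (x i)) fun _ _ h => h.mono fun i hi => congrArg (f i) hi

/-- The coordinatewise extension of a family of binary operations. -/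
def map₂ (f : ∀ i, M i → M i → M i) :
    (U : Filter ι).Product M → (U : Filter ι).Product M → (U : Filter ι).Product M :=
  Quotient.map₂ (fun x y i => f i (x i) (y i)) fun _ _ h _ _ h' =>
    (h.and h').mono fun i hi => congrArg₂ (f i) hi.1 hi.2

/-- The ultraproduct of a family of groups. -/
instance instGroup [∀ i, Group (M i)] : Group ((U : Filter ι).Product M) where
  mul := map₂ fun _ a b => a * b
  one := mk U fun _ => 1
  inv := map fun _ a => a⁻¹
  mul_assoc a b c := by
    obtain ⟨a, rfl⟩ := mk_surjective a
    obtain ⟨b, rfl⟩ := mk_surjective b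
    obtain ⟨c, rfl⟩ := mk_surjective c
    exact mk_eq_mk.2 (.of_forall fun i => mul_assoc (a i) (b i) (c i))
  one_mul a := by
    obtain ⟨a, rfl⟩ := mk_surjective a
    exact mk_eq_mk.2 (.of_forall fun i => one_mul (a i))
  mul_one a := by
    obtain ⟨a, rfl⟩ := mk_surjective a
    exact mk_eq_mk.2 (.of_forall fun i => mul_one (a i))
  inv_mul_cancel a := by
    obtain ⟨a, rfl⟩ := mk_surjective a
    exact mk_eq_mk.2 (.of_forall fun i => inv_mul_cancel (a i))

/-- The ultraproduct of a family of fields. -/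
instance instField [∀ i, Field (M i)] : Field ((U : Filter ι).Product M) where
  add := map₂ fun _ a b => a + b
  zero := mk U fun _ => 0
  neg := map fun _ a => -a
  mul := map₂ fun _ a b => a * b
  one := mk U fun _ => 1
  inv := map fun _ a => a⁻¹
  nsmul n := map fun _ a => n • a
  nsmul_zero a := by
    obtain ⟨a, rfl⟩ := mk_surjective a
    exact mk_eq_mk.2 (.of_forall fun i => zero_nsmul (a i))
  nsmul_succ n a := by
    obtain ⟨a, rfl⟩ := mk_surjective a
    exact mk_eq_mk.2 (.of_forall fun i => succ_nsmul (a i) n)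
  zsmul n := map fun _ a => n • a
  zsmul_zero' a := by
    obtain ⟨a, rfl⟩ := mk_surjective a
    exact mk_eq_mk.2 (.of_forall fun i => zero_zsmul (a i))
  zsmul_succ' n a := by
    obtain ⟨a, rfl⟩ := mk_surjective a
    exact mk_eq_mk.2 (.of_forall fun i => SubNegMonoid.zsmul_succ' n (a i))
  zsmul_neg' n a := by
    obtain ⟨a, rfl⟩ := mk_surjective a
    exact mk_eq_mk.2 (.of_forall fun i => SubNegMonoid.zsmul_neg' n (a i))
  nnqsmul := _
  qsmul := _
  add_assoc a b c := by
    obtain ⟨a, rfl⟩ := mk_surjective a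
    obtain ⟨b, rfl⟩ := mk_surjective b
    obtain ⟨c, rfl⟩ := mk_surjective c
    exact mk_eq_mk.2 (.of_forall fun i => add_assoc (a i) (b i) (c i))
  zero_add a := by
    obtain ⟨a, rfl⟩ := mk_surjective a
    exact mk_eq_mk.2 (.of_forall fun i => zero_add (a i))
  add_zero a := by
    obtain ⟨a, rfl⟩ := mk_surjective a
    exact mk_eq_mk.2 (.of_forall fun i => add_zero (a i))
  add_comm a b := by
    obtain ⟨a, rfl⟩ := mk_surjective a
    obtain ⟨b, rfl⟩ := mk_surjective b
    exact mk_eq_mk.2 (.of_forall fun i => add_comm (a i) (b i))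
  neg_add_cancel a := by
    obtain ⟨a, rfl⟩ := mk_surjective a
    exact mk_eq_mk.2 (.of_forall fun i => neg_add_cancel (a i))
  mul_assoc a b c := by
    obtain ⟨a, rfl⟩ := mk_surjective a
    obtain ⟨b, rfl⟩ := mk_surjective b
    obtain ⟨c, rfl⟩ := mk_surjective c
    exact mk_eq_mk.2 (.of_forall fun i => mul_assoc (a i) (b i) (c i))
  mul_comm a b := by
    obtain ⟨a, rfl⟩ := mk_surjective a
    obtain ⟨b, rfl⟩ := mk_surjective b
    exact mk_eq_mk.2 (.of_forall fun i => mul_comm (a i) (b i))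
  one_mul a := by
    obtain ⟨a, rfl⟩ := mk_surjective a
    exact mk_eq_mk.2 (.of_forall fun i => one_mul (a i))
  mul_one a := by
    obtain ⟨a, rfl⟩ := mk_surjective a
    exact mk_eq_mk.2 (.of_forall fun i => mul_one (a i))
  zero_mul a := by
    obtain ⟨a, rfl⟩ := mk_surjective a
    exact mk_eq_mk.2 (.of_forall fun i => zero_mul (a i))
  mul_zero a := by
    obtain ⟨a, rfl⟩ := mk_surjective a
    exact mk_eq_mk.2 (.of_forall fun i => mul_zero (a i))
  left_distrib a b c := by
    obtain ⟨a, rfl⟩ := mk_surjective a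
    obtain ⟨b, rfl⟩ := mk_surjective b
    obtain ⟨c, rfl⟩ := mk_surjective c
    exact mk_eq_mk.2 (.of_forall fun i => mul_add (a i) (b i) (c i))
  right_distrib a b c := by
    obtain ⟨a, rfl⟩ := mk_surjective a
    obtain ⟨b, rfl⟩ := mk_surjective b
    obtain ⟨c, rfl⟩ := mk_surjective c
    exact mk_eq_mk.2 (.of_forall fun i => add_mul (a i) (b i) (c i))
  exists_pair_ne := ⟨mk U fun _ => 0, mk U fun _ => 1, fun h => by
    obtain ⟨i, hi⟩ := (mk_eq_mk.1 h).exists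
    exact zero_ne_one hi⟩
  mul_inv_cancel a ha := by
    obtain ⟨a, rfl⟩ := mk_surjective a
    have h : ¬ ∀ᶠ i in (U : Filter ι), a i = 0 := fun h => ha (mk_eq_mk.2 h)
    exact mk_eq_mk.2 ((Ultrafilter.eventually_not.2 h).mono fun i hi => mul_inv_cancel₀ hi)
  inv_zero := mk_eq_mk.2 (.of_forall fun _ => inv_zero)

end Ultraproducts

/-- An ultrafilter is non-principal if it is not generated by a point. -/
def IsNonprincipal {ι : Type*} (U : Ultrafilter ι) : Prop := ∀ i : ι, U ≠ pure i

/-! ### The first-order language of groups -/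

/-- The function symbols of the language of groups. -/
inductive GroupFunc : ℕ → Type
  | one : GroupFunc 0
  | inv : GroupFunc 1
  | mul : GroupFunc 2

/-- The language of groups: one, inverse, multiplication, and no relation symbol. -/
def groupLanguage : FirstOrder.Language := ⟨GroupFunc, fun _ => Empty⟩

/-- A group as a structure for the language of groups. -/
@[reducible] def groupStructure (G : Type*) [Group G] : groupLanguage.Structure G where
  funMap := fun {_} f => match f with
    | .one => fun _ => 1
    | .inv => fun x => (x 0)⁻¹
    | .mul => fun x => x 0 * x 1
  RelMap := fun {_} r => nomatch r

/-- The group `G` satisfies the first-order sentence `φ`. -/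
def GroupSatisfies (G : Type*) [Group G] (φ : groupLanguage.Sentence) : Prop :=
  @FirstOrder.Language.Sentence.Realize groupLanguage G (groupStructure G) φ

/-- The field `K` satisfies the first-order sentence `φ` of the language of rings. -/
def FieldSatisfies (K : Type*) [Field K] (φ : FirstOrder.Language.ring.Sentence) : Prop :=
  @FirstOrder.Language.Sentence.Realize FirstOrder.Language.ring K
    (FirstOrder.Ring.compatibleRingOfRing K).toStructure φ

/-- A pseudofinite group: an infinite model of the common theory of all finite groups. -/
def IsPseudofiniteGroup (G : Type*) [Group G] : Prop :=
  Infinite G ∧ ∀ φ : groupLanguage.Sentence,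
    (∀ (H : Type) [Group H] [Finite H], GroupSatisfies H φ) → GroupSatisfies G φ

/-- A pseudofinite field: an infinite model of the common theory of all finite fields. -/
def IsPseudofiniteField (K : Type*) [Field K] : Prop :=
  Infinite K ∧ ∀ φ : FirstOrder.Language.ring.Sentence,
    (∀ (k : Type) [Field k] [Finite k], FieldSatisfies k φ) → FieldSatisfies K φ

/-- A linear group: a group isomorphic to a subgroup of some `GL_n(K)`, with `K` a field. -/
def IsLinearGroup (G : Type) [Group G] : Prop :=
  ∃ (n : ℕ) (K : Type) (_ : Field K) (H : Subgroup (GL (Fin n) K)), Nonempty (G ≃* H)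

/-! ### Vol'vachev's conditions -/

/-- `-1` is a sum of two squares in `K`. -/
def V1 (K : Type*) [Field K] : Prop := ∃ a b : K, a ^ 2 + b ^ 2 = -1

/-- `K` has no element of multiplicative order `4`. -/
def V2 (K : Type*) [Field K] : Prop := ∀ x : K, orderOf x ≠ 4

/-- Every element `a + bi` of `K(i)` whose multiplicative order is a power of `2` satisfies
`(a + bi)(a - bi) = 1`. Here `i` is a square root of `-1` in an algebraic closure of `K`. -/
def V3 (K : Type*) [Field K] : Prop :=
  ∀ i : AlgebraicClosure K, i ^ 2 = -1 → ∀ a b : K,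
    (∃ n : ℕ, orderOf (algebraMap K (AlgebraicClosure K) a + algebraMap K _ b * i) = 2 ^ n) →
      (algebraMap K (AlgebraicClosure K) a + algebraMap K _ b * i) *
        (algebraMap K (AlgebraicClosure K) a - algebraMap K _ b * i) = 1

/-! ### Classes of groups -/

/-- The class of groups in which, for each prime `p`, any two Sylow `p`-subgroups (maximal
`p`-subgroups) are conjugate; `g • P` is the conjugate `g P g⁻¹`. -/
def HasConjugateSylows (G : Type) [Group G] : Prop :=
  ∀ p : ℕ, p.Prime → ∀ P Q : Sylow p G, ∃ g : G, g • P = Q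

/-- A class of groups is closed under ultraproducts. -/
def ClosedUnderUltraproducts (C : ∀ (G : Type) [Group G], Prop) : Prop :=
  ∀ (ι : Type) (U : Ultrafilter ι) (G : ι → Type) [∀ i, Group (G i)],
    (∀ i, C (G i)) → C ((U : Filter ι).Product G)

/-- A class of groups is elementary: it is the class of groups satisfying some first-order
theory. -/
def IsElementaryClass (C : ∀ (G : Type) [Group G], Prop) : Prop :=
  ∃ T : groupLanguage.Theory, ∀ (G : Type) [Group G], C G ↔ ∀ φ ∈ T, GroupSatisfies G φ

/-! ### The construction -/

/-- An infinite set `J` of primes congruent to `3` modulo `4` such that, for each `N`, `2 ^ N`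
divides `p + 1` for all but finitely many `p ∈ J`. -/
structure IsAdmissible (J : Set Nat.Primes) : Prop where
  infinite : J.Infinite
  mod_four : ∀ p ∈ J, (p : ℕ) % 4 = 3
  dvd : ∀ N : ℕ, {p ∈ J | ¬ 2 ^ N ∣ (p : ℕ) + 1}.Finite

instance instFactPrime (p : Nat.Primes) : Fact (p : ℕ).Prime := ⟨p.2⟩

/-- The ultraproduct of the prime fields `𝔽_p`, `p ∈ J`, over the ultrafilter `U` on `J`. -/
abbrev ultraField (J : Set Nat.Primes) (U : Ultrafilter J) : Type :=
  (U : Filter J).Product fun p => ZMod ((p : Nat.Primes) : ℕ)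

end SylowUltra

end

/-!
An ultraproduct of finite groups can have nonconjugate Sylow subgroups because being a `p`-group
is not a first-order property: here the Sylow `2`-subgroups of the groups `GL 2 (𝔽_p)` have
unbounded exponent, and their ultraproduct is not a `2`-group.

The arithmetic is in `trace_eq_zero_of_pow_succ_eq_one`. If `2 ^ n` divides `p + 1`, then a
matrix `g` over `𝔽_p` with `g ^ 2 ^ n = 1` and determinant `-1` has trace zero, because the
Frobenius map permutes its two eigenvalues. For an admissible set of primes, each power of two
divides almost all the numbers `p + 1`, so the ultraproduct `F` satisfies the condition for all
`n` simultaneously (`IsAdmissible.traceCondition_ultraField`). This also yields the condition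
`V3`, when applied to the matrices `!![a, -b; b, a]` that represent the elements `a + bi`.

Two Sylow `2`-subgroups are then told apart by the determinant. One contains `diag(1, -1)`, of
determinant `-1`. The other contains a quaternion group of order eight inside `SL 2 (F)`, which
exists because `-1` is a sum of two squares. Such a Sylow subgroup lies in `SL 2 (F)`
(`exists_sylow_det_eq_one`): for `g` in it of determinant `-1`, the products of `g` with the
elements of the quaternion group have determinant `-1` too, hence trace zero; the quaternion
group spans the algebra of matrices and the trace form is nondegenerate, so `g` would be zero.

Łoś's theorem gives pseudofiniteness, and shows that an elementary class is closed under
ultraproducts. Since `GL 2 (F)` is isomorphic to the ultraproduct of the finite groups `GL 2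
(𝔽_p)` (`glUltraproductEquiv`), in which Sylow subgroups are conjugate, the class of groups with
conjugate Sylow subgroups is neither closed under ultraproducts nor elementary.
-/

open scoped MatrixGroups

noncomputable section

namespace SylowUltra

open Filter FirstOrder

/-! ### Łoś's theorem for the ultraproducts of groups and of fields -/

section Los

variable {ι : Type*} {U : Ultrafilter ι}

theorem groupSatisfies_ultraproduct {G : ι → Type*} [∀ i, Group (G i)]
    (φ : groupLanguage.Sentence) :
    GroupSatisfies ((U : Filter ι).Product G) φ ↔
      ∀ᶠ i in (U : Filter ι), GroupSatisfies (G i) φ := by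
  let : ∀ i, groupLanguage.Structure (G i) := fun i => groupStructure (G i)
  -- the structure given by the group operations is the one in Mathlib's form of Łoś's theorem
  have h : groupStructure ((U : Filter ι).Product G) =
      Language.Ultraproduct.structure (L := groupLanguage) := by
    refine Language.Structure.ext ?_ ?_
    · funext n f x
      choose y hy using fun i => mk_surjective (x i)
      obtain rfl : (fun i => mk U (y i)) = x := funext hy
      refine Eq.trans ?_ (Language.Ultraproduct.funMap_cast f y).symm
      cases f <;> rfl
    · funext n r
      cases r
  unfold GroupSatisfies
  rw [h]
  exact Language.Ultraproduct.sentence_realize φ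

theorem fieldSatisfies_ultraproduct {K : ι → Type*} [∀ i, Field (K i)]
    (φ : Language.ring.Sentence) :
    FieldSatisfies ((U : Filter ι).Product K) φ ↔
      ∀ᶠ i in (U : Filter ι), FieldSatisfies (K i) φ := by
  let : ∀ i, Language.ring.Structure (K i) := fun i =>
    (Ring.compatibleRingOfRing (K i)).toStructure
  -- the structure given by the field operations is the one in Mathlib's form of Łoś's theorem
  have h : (Ring.compatibleRingOfRing ((U : Filter ι).Product K)).toStructure =
      Language.Ultraproduct.structure (L := Language.ring) := by
    refine Language.Structure.ext ?_ ?_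
    · funext n f x
      choose y hy using fun i => mk_surjective (x i)
      obtain rfl : (fun i => mk U (y i)) = x := funext hy
      refine Eq.trans ?_ (Language.Ultraproduct.funMap_cast f y).symm
      cases f <;> rfl
    · funext n r
      cases r
  unfold FieldSatisfies
  rw [h]
  exact Language.Ultraproduct.sentence_realize φ

theorem groupSatisfies_congr {G H : Type*} [Group G] [Group H] (e : G ≃* H)
    (φ : groupLanguage.Sentence) : GroupSatisfies G φ ↔ GroupSatisfies H φ := by
  let := groupStructure G
  let := groupStructure H
  let E : Language.Equiv groupLanguage G H :=
    { e.toEquiv with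
      map_fun' := by
        intro n f x
        cases f
        · exact map_one e
        · exact map_inv e _
        · exact map_mul e _ _
      map_rel' := by
        intro n r
        cases r }
  exact Language.StrongHomClass.realize_sentence E φ

theorem IsElementaryClass.closedUnderUltraproducts {C : ∀ (G : Type) [Group G], Prop}
    (hC : IsElementaryClass C) : ClosedUnderUltraproducts C := by
  obtain ⟨T, hT⟩ := hC
  intro ι U G _ hG
  refine (hT _).2 fun φ hφ => (groupSatisfies_ultraproduct φ).2 (.of_forall fun i => ?_)
  exact (hT _).1 (hG i) φ hφ

end Los

/-! ### Conjugacy of Sylow subgroups -/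

theorem hasConjugateSylows_of_finite (G : Type) [Group G] [Finite G] : HasConjugateSylows G := by
  intro p hp P Q
  have : Fact p.Prime := ⟨hp⟩
  exact MulAction.exists_smul_eq G P Q

theorem HasConjugateSylows.of_mulEquiv {G H : Type} [Group G] [Group H] (e : G ≃* H)
    (hG : HasConjugateSylows G) : HasConjugateSylows H := by
  intro p hp P Q
  obtain ⟨g, hg⟩ := hG p hp (P.comapOfInjective e.toMonoidHom e.injective (by simp))
    (Q.comapOfInjective e.toMonoidHom e.injective (by simp))
  refine ⟨e g, ?_⟩
  ext y
  obtain ⟨x, rfl⟩ := e.surjective y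
  have hx := SetLike.ext_iff.1 (congrArg Sylow.toSubgroup hg) x
  rw [Sylow.coe_subgroup_smul, Subgroup.mem_pointwise_smul_iff_inv_smul_mem] at hx
  change e x ∈ ((e g • P : Sylow p H) : Subgroup H) ↔ e x ∈ (Q : Subgroup H)
  rw [Sylow.coe_subgroup_smul, Subgroup.mem_pointwise_smul_iff_inv_smul_mem]
  simpa [MulAut.smul_def, ← map_inv] using hx

/-! ### The general linear group of an ultraproduct of fields -/

section GeneralLinear

variable {ι : Type*} (U : Ultrafilter ι) (K : ι → Type*) [∀ i, Field (K i)]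

/-- The projection of the product of a family of fields onto its ultraproduct. -/
def mkHom : (∀ i, K i) →+* (U : Filter ι).Product K where
  toFun := mk U
  map_one' := rfl
  map_mul' _ _ := rfl
  map_zero' := rfl
  map_add' _ _ := rfl

variable (n : Type*) [Fintype n] [DecidableEq n]

/-- A family of matrices over the fields `K i`, read entrywise as a matrix over the
ultraproduct. -/
def matrixMk : (∀ i, Matrix n n (K i)) →* Matrix n n ((U : Filter ι).Product K) where
  toFun X := Matrix.of fun a b => mk U fun i => X i a b
  map_one' := by
    ext a b
    by_cases h : a = b
    · subst h
      simp only [Pi.one_apply, Matrix.of_apply, Matrix.one_apply_eq]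
      rfl
    · simp only [Pi.one_apply, Matrix.of_apply, Matrix.one_apply_ne h]
      rfl
  map_mul' X Y := by
    ext a b
    simp only [Matrix.of_apply, Matrix.mul_apply, Pi.mul_apply]
    change mkHom U K _ = ∑ j, mkHom U K (fun i => X i a j) * mkHom U K (fun i => Y i j b)
    simp only [← map_mul, ← map_sum]
    congr 1
    funext i
    simp

/-- A family of invertible matrices over the fields `K i`, read entrywise as an invertible matrix
over the ultraproduct. -/
def glMk : (∀ i, GL n (K i)) →* GL n ((U : Filter ι).Product K) :=
  (Units.map (matrixMk U K n)).comp MulEquiv.piUnits.symm.toMonoidHom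

variable {U K n}

theorem glMk_apply (x : ∀ i, GL n (K i)) (a b : n) :
    (glMk U K n x) a b = mk U fun i => x i a b := rfl

theorem glMk_eq_iff {x y : ∀ i, GL n (K i)} :
    glMk U K n x = glMk U K n y ↔ ∀ᶠ i in (U : Filter ι), x i = y i := by
  simp only [Matrix.GeneralLinearGroup.ext_iff, glMk_apply, mk_eq_mk, eventually_all]

theorem glMk_surjective : Function.Surjective (glMk U K n) := by
  intro g
  -- representatives of `g` and of `g⁻¹` are mutually inverse almost everywhere
  choose X hX using fun a b => mk_surjective (g a b)
  choose Y hY using fun a b => mk_surjective (g⁻¹ a b)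
  have hXY : ∀ᶠ i in (U : Filter ι),
      (Matrix.of fun a b => X a b i) * (Matrix.of fun a b => Y a b i) = 1 := by
    have hg : (g : Matrix n n ((U : Filter ι).Product K)) * (g⁻¹ : GL n _) = 1 := g.mul_inv
    have h1 : (g : Matrix n n ((U : Filter ι).Product K)) =
        matrixMk U K n fun i => Matrix.of fun a b => X a b i := by
      ext a b
      exact (hX a b).symm
    have h2 : ((g⁻¹ : GL n _) : Matrix n n ((U : Filter ι).Product K)) =
        matrixMk U K n fun i => Matrix.of fun a b => Y a b i := by
      ext a b
      exact (hY a b).symm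
    rw [h1, h2, ← map_mul, ← map_one (matrixMk U K n)] at hg
    simp only [← Matrix.ext_iff, eventually_all]
    exact fun a b => mk_eq_mk.1 (congrFun (congrFun hg a) b)
  classical
  refine ⟨fun i => if h : (Matrix.of fun a b => X a b i) * (Matrix.of fun a b => Y a b i) = 1
    then ⟨_, _, h, mul_eq_one_comm.1 h⟩ else 1, ?_⟩
  refine Matrix.GeneralLinearGroup.ext fun a b => ?_
  rw [glMk_apply, ← hX a b, mk_eq_mk]
  filter_upwards [hXY] with i hi
  rw [dif_pos hi]
  rfl

theorem det_glMk (x : ∀ i, GL n (K i)) :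
    (glMk U K n x : Matrix n n ((U : Filter ι).Product K)).det =
      mk U fun i => (x i : Matrix n n (K i)).det := by
  let X : Matrix n n (∀ i, K i) := Matrix.of fun a b i => x i a b
  have hX : X.det = fun i => (x i : Matrix n n (K i)).det :=
    funext fun i => (Pi.evalRingHom K i).map_det X
  exact ((mkHom U K).map_det X).symm.trans (congrArg (mk U) hX)

theorem trace_glMk (x : ∀ i, GL n (K i)) :
    (glMk U K n x : Matrix n n ((U : Filter ι).Product K)).trace =
      mk U fun i => (x i : Matrix n n (K i)).trace := by
  let X : Matrix n n (∀ i, K i) := Matrix.of fun a b i => x i a b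
  have hX : X.trace = fun i => (x i : Matrix n n (K i)).trace :=
    funext fun i => AddMonoidHom.map_trace (Pi.evalRingHom K i) X
  exact (AddMonoidHom.map_trace (mkHom U K) X).symm.trans (congrArg (mk U) hX)

variable (U K n)

/-- Forming `GL n` commutes with ultraproducts. -/
def glUltraproductEquiv :
    (U : Filter ι).Product (fun i => GL n (K i)) ≃* GL n ((U : Filter ι).Product K) :=
  MulEquiv.ofBijective
    (M := (U : Filter ι).Product (fun i => GL n (K i)))
    (F := (U : Filter ι).Product (fun i => GL n (K i)) →* GL n ((U : Filter ι).Product K))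
    { toFun := Quotient.lift (glMk U K n) fun _ _ h => glMk_eq_iff.2 h
      map_one' := map_one (glMk U K n)
      map_mul' := by
        intro x y
        obtain ⟨x, rfl⟩ := mk_surjective x
        obtain ⟨y, rfl⟩ := mk_surjective y
        exact map_mul (glMk U K n) x y }
    ⟨by
      intro x y h
      obtain ⟨x, rfl⟩ := mk_surjective x
      obtain ⟨y, rfl⟩ := mk_surjective y
      exact mk_eq_mk.2 (glMk_eq_iff.1 h), fun g => by
      obtain ⟨x, rfl⟩ := glMk_surjective g
      exact ⟨mk U x, rfl⟩⟩

end GeneralLinear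

/-! ### Admissible sets of primes -/

theorem infinite_primes_dvd_add_one (N : ℕ) :
    {p : Nat.Primes | (p : ℕ) % 4 = 3 ∧ 2 ^ N ∣ (p : ℕ) + 1}.Infinite := by
  -- Dirichlet's theorem for the class of `-1` modulo `2 ^ (N + 2)`
  have key : ∀ n : ℕ, ∃ p : Nat.Primes, n < p ∧ (p : ℕ) % 4 = 3 ∧ 2 ^ N ∣ (p : ℕ) + 1 := by
    intro n
    obtain ⟨p, hn, hp, hpm⟩ := Nat.forall_exists_prime_gt_and_eq_mod
      (q := 2 ^ (N + 2)) (a := -1) isUnit_one.neg n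
    have hd : 2 ^ (N + 2) ∣ p + 1 := by
      rw [← ZMod.natCast_eq_zero_iff]
      push_cast at hpm ⊢
      rw [hpm, neg_add_cancel]
    refine ⟨⟨p, hp⟩, hn, ?_, (pow_dvd_pow 2 (by omega)).trans hd⟩
    have h4 : 4 ∣ p + 1 := (pow_dvd_pow 2 (by omega : 2 ≤ N + 2)).trans hd
    change p % 4 = 3
    omega
  intro hfin
  obtain ⟨B, hB⟩ := (hfin.image (fun p : Nat.Primes => (p : ℕ))).bddAbove
  obtain ⟨p, hp, hp'⟩ := key B
  exact absurd (hB ⟨p, hp', rfl⟩) (not_le.2 hp)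

theorem exists_isAdmissible : ∃ J : Set Nat.Primes, IsAdmissible J := by
  choose f hf using fun N => (infinite_primes_dvd_add_one N).nonempty
  have hdvd : ∀ {N M : ℕ}, N ≤ M → 2 ^ N ∣ (f M : ℕ) + 1 := fun h =>
    (pow_dvd_pow 2 h).trans (hf _).2
  refine ⟨Set.range f, ?_, ?_, fun N => ?_⟩
  · intro hfin
    obtain ⟨B, hB⟩ := (hfin.image (fun p : Nat.Primes => (p : ℕ))).bddAbove
    have h1 : (f (B + 1) : ℕ) ≤ B := hB ⟨_, ⟨B + 1, rfl⟩, rfl⟩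
    have h2 := Nat.le_of_dvd (Nat.succ_pos _) (hf (B + 1)).2
    have h3 : B + 1 < 2 ^ (B + 1) := Nat.lt_two_pow_self
    omega
  · rintro _ ⟨N, rfl⟩
    exact (hf N).1
  · refine ((Set.finite_Iio N).image f).subset ?_
    rintro _ ⟨⟨M, rfl⟩, hM⟩
    exact ⟨M, not_le.1 fun h => hM (hdvd h), rfl⟩

theorem IsNonprincipal.le_cofinite {ι : Type*} {U : Ultrafilter ι} (hU : IsNonprincipal U) :
    (U : Filter ι) ≤ cofinite :=
  U.le_cofinite_or_eq_pure.resolve_right fun ⟨i, hi⟩ => hU i hi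

theorem exists_isNonprincipal (ι : Type*) [Infinite ι] :
    ∃ U : Ultrafilter ι, IsNonprincipal U := by
  refine ⟨hyperfilter ι, fun i hi => ?_⟩
  have h : ({i} : Set ι) ∈ hyperfilter ι := hi ▸ mem_pure.2 rfl
  exact (Set.finite_singleton i).notMem_hyperfilter h

/-! ### Elements of `GL 2` of order a power of two -/

/-- An eigenvalue `x` of `g` satisfies `x ^ (p + 1) = 1`, and the Frobenius map either fixes `x`
or exchanges it with the other eigenvalue `-1 / x`. In the first case `x ^ 2 = 1`, whence the trace
`x - 1 / x` vanishes; in the second one `1 = x ^ (p + 1) = x * (-1 / x) = -1`, which is absurd. -/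
theorem trace_eq_zero_of_pow_succ_eq_one {p : ℕ} [Fact p.Prime] (hp : p ≠ 2)
    {g : Matrix (Fin 2) (Fin 2) (ZMod p)} (hg : g ^ (p + 1) = 1) (hdet : g.det = -1) :
    g.trace = 0 := by
  let L := AlgebraicClosure (ZMod p)
  let φ : ZMod p →+* L := algebraMap (ZMod p) L
  have hφ (a : ZMod p) : φ a ^ p = φ a := by rw [← map_pow, ZMod.pow_card]
  have : CharP L p := charP_of_injective_algebraMap φ.injective p
  have h2 : (2 : L) ≠ 0 := Ring.two_ne_zero ((ringChar.eq L p).symm ▸ hp)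
  let G : Matrix (Fin 2) (Fin 2) L := φ.mapMatrix g
  obtain ⟨x, hx⟩ := Module.End.exists_eigenvalue (Matrix.toLinAlgEquiv' G)
  obtain ⟨v, hv⟩ := hx.exists_hasEigenvector
  have root (P : Polynomial L) (hP : Polynomial.aeval G P = 0) : P.eval x = 0 := by
    have h := Module.End.aeval_apply_of_hasEigenvector (p := P) hv
    rw [Polynomial.aeval_algHom_apply (Matrix.toLinAlgEquiv' (R := L)) G P, hP] at h
    simpa [hv.2] using h.symm
  have hpow : x ^ (p + 1) = 1 := by
    have hG : G ^ (p + 1) = 1 := by rw [← map_pow, hg, map_one]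
    have h := root (Polynomial.X ^ (p + 1) - 1) (by simp [hG])
    rwa [Polynomial.eval_sub, Polynomial.eval_pow, Polynomial.eval_X, Polynomial.eval_one,
      sub_eq_zero] at h
  have hquad : x ^ 2 - φ g.trace * x - 1 = 0 := by
    have hGd : G.det = -1 := by rw [← RingHom.map_det, hdet, map_neg, map_one]
    have hGt : G.trace = φ g.trace := (AddMonoidHom.map_trace φ g).symm
    simpa [Matrix.charpoly_fin_two, hGd, hGt, ← sub_eq_add_neg] using
      root _ G.aeval_self_charpoly
  have hx0 : x ≠ 0 := by
    rintro rfl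
    simp at hpow
  -- the trace lies in `𝔽_p`, so the Frobenius map permutes the roots of the quadratic polynomial
  have hfrob : (x ^ p) ^ 2 - φ g.trace * x ^ p - 1 = 0 := by
    have h := congrArg (frobenius L p) hquad
    simp only [map_sub, map_mul, map_pow, map_one, map_zero, frobenius_def, hφ] at h
    exact h
  have hcase : (x ^ p - x) * (x ^ p + x - φ g.trace) = 0 := by linear_combination hfrob - hquad
  rcases mul_eq_zero.1 hcase with h | h
  · have hx2 : x ^ 2 = 1 := by
      rw [pow_succ, sub_eq_zero.1 h] at hpow
      rw [sq, hpow]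
    have : φ g.trace * x = 0 := by linear_combination hx2 - hquad
    exact φ.injective (by simpa [hx0] using this)
  · refine absurd ?_ h2
    linear_combination x * h - hquad - hpow

/-- Without elements of order four, the elements of order a power of two are `1` and `-1`. -/
theorem eq_one_or_eq_neg_one_of_pow_two_pow {K : Type*} [Field K] (h2 : V2 K) {d : K} {n : ℕ}
    (hd : d ^ 2 ^ n = 1) : d = 1 ∨ d = -1 := by
  induction n generalizing d with
  | zero => exact .inl (by simpa using hd)
  | succ n ih =>
    rw [pow_succ', pow_mul] at hd
    rcases ih hd with h | h
    · exact sq_eq_one_iff.1 h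
    · by_cases h1 : (1 : K) = -1
      · exact sq_eq_one_iff.1 (h.trans h1.symm)
      · refine absurd (orderOf_eq_prime_pow (p := 2) (n := 1) (x := d) ?_ ?_) (h2 d)
        · simpa [h] using Ne.symm h1
        · rw [show 2 ^ (1 + 1) = 2 * 2 from rfl, pow_mul, h, neg_one_sq]

theorem not_sq_eq_neg_one {K : Type*} [Field K] (hc : (2 : K) ≠ 0) (h2 : V2 K) (x : K) :
    x ^ 2 ≠ -1 := by
  intro hx
  have h : x ^ 2 ^ 2 = 1 := by rw [show 2 ^ 2 = 2 * 2 from rfl, pow_mul, hx, neg_one_sq]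
  apply hc
  rcases eq_one_or_eq_neg_one_of_pow_two_pow h2 h with rfl | rfl <;> linear_combination hx

/-- The condition that an invertible `2 × 2` matrix over `K` of order a power of two and
determinant `-1` has trace zero; by the Cayley–Hamilton theorem it is then an involution. -/
def TraceCondition (K : Type*) [Field K] : Prop :=
  ∀ (g : GL (Fin 2) K) (n : ℕ), g ^ 2 ^ n = 1 → (g : Matrix (Fin 2) (Fin 2) K).det = -1 →
    (g : Matrix (Fin 2) (Fin 2) K).trace = 0

/-- The matrix `!![a, -b; b, a]` represents `a + bi`, and its determinant is the norm
`(a + bi)(a - bi)`, which is `1` or `-1` when `a + bi` has order a power of two. If it were `-1`,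
the trace condition would give `a = 0`, and `b` would be a square root of `-1`. -/
theorem TraceCondition.v3 {K : Type*} [Field K] (hc : (2 : K) ≠ 0) (h2 : V2 K)
    (hK : TraceCondition K) : V3 K := by
  intro i hi a b ⟨n, hn⟩
  let φ : K →+* AlgebraicClosure K := algebraMap K (AlgebraicClosure K)
  change (φ a + φ b * i) * (φ a - φ b * i) = 1
  let z := φ a + φ b * i
  have hz : z ^ 2 ^ n = 1 := hn ▸ pow_orderOf_eq_one z
  let M : Matrix (Fin 2) (Fin 2) K := !![a, -b; b, a]
  have hM (k : ℕ) : ∃ c d : K, M ^ k = !![c, -d; d, c] ∧ z ^ k = φ c + φ d * i := by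
    induction k with
    | zero => exact ⟨1, 0, by simp [Matrix.one_fin_two], by simp⟩
    | succ k ih =>
      obtain ⟨c, d, h, h'⟩ := ih
      refine ⟨c * a - d * b, c * b + d * a, ?_, ?_⟩
      · rw [pow_succ, h]
        ext r s
        fin_cases r <;> fin_cases s <;> simp [M, Matrix.mul_apply] <;> ring
      · rw [pow_succ, h']
        simp only [z, map_add, map_sub, map_mul]
        linear_combination φ d * φ b * hi
  obtain ⟨c, d, h, h'⟩ := hM (2 ^ n)
  rw [hz] at h'
  -- `1` and `i` are linearly independent over `K`
  have hd : d = 0 := by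
    by_contra hd
    have hd' : φ d ≠ 0 := (map_ne_zero φ).2 hd
    refine not_sq_eq_neg_one hc h2 ((1 - c) / d) (φ.injective ?_)
    have : φ ((1 - c) / d) = i := by
      rw [map_div₀, map_sub, map_one, div_eq_iff hd']
      linear_combination h'
    rw [map_pow, this, hi, map_neg, map_one]
  have hc1 : c = 1 := φ.injective (by simpa [hd] using h'.symm)
  have hM1 : M ^ 2 ^ n = 1 := by rw [h, hd, hc1, Matrix.one_fin_two, neg_zero]
  have hdet : M.det = a ^ 2 + b ^ 2 := by simp [M, Matrix.det_fin_two_of]; ring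
  have hdet1 : M.det ^ 2 ^ n = 1 := by rw [← Matrix.det_pow, hM1, Matrix.det_one]
  suffices M.det = 1 by
    have := congrArg φ (hdet.symm.trans this)
    simp only [map_add, map_pow, map_one] at this
    linear_combination this - φ b ^ 2 * hi
  refine (eq_one_or_eq_neg_one_of_pow_two_pow h2 hdet1).resolve_right fun hneg => ?_
  have htr := hK (Units.ofPowEqOne M (2 ^ n) hM1 (by positivity)) n
    (Units.ext (by simp)) hneg
  have ha : a = 0 := by
    have : 2 * a = 0 := by simpa [M, Matrix.trace_fin_two, two_mul] using htr
    exact (mul_eq_zero.1 this).resolve_left hc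
  refine not_sq_eq_neg_one hc h2 b ?_
  rw [← hneg, hdet, ha]
  ring

/-! ### Nonconjugate Sylow subgroups of `GL 2` -/

/-- The traces of `g`, `gI`, `gJ` and `gIJ` determine `g`, since `1`, `I`, `J`, `IJ` is a basis of
the algebra of `2 × 2` matrices when `-1 = a ^ 2 + b ^ 2`. -/
theorem eq_zero_of_trace_mul_eq_zero {K : Type*} [Field K] (hc : (2 : K) ≠ 0) {a b : K}
    (hab : a ^ 2 + b ^ 2 = -1) (g : Matrix (Fin 2) (Fin 2) K) (h1 : g.trace = 0)
    (hI : (g * !![0, -1; 1, 0]).trace = 0) (hJ : (g * !![a, b; b, -a]).trace = 0)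
    (hIJ : (g * (!![0, -1; 1, 0] * !![a, b; b, -a])).trace = 0) : g = 0 := by
  simp only [Matrix.trace_fin_two, Matrix.mul_apply, Fin.sum_univ_two, Matrix.of_apply,
    Matrix.cons_val_zero, Matrix.cons_val_one, Matrix.cons_val'] at h1 hI hJ hIJ
  have e00 : g 0 0 = 0 := by
    refine (mul_eq_zero.1 (?_ : 2 * g 0 0 = 0)).resolve_left hc
    linear_combination -a * hJ + b * hIJ + 2 * g 0 0 * hab - (a ^ 2 + b ^ 2) * h1
  have e01 : g 0 1 = 0 := by
    refine (mul_eq_zero.1 (?_ : 2 * g 0 1 = 0)).resolve_left hc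
    linear_combination -b * hJ - a * hIJ + 2 * g 0 1 * hab - (a ^ 2 + b ^ 2) * hI
  have e11 : g 1 1 = 0 := by linear_combination h1 - e00
  have e10 : g 1 0 = 0 := by linear_combination e01 - hI
  ext r s
  fin_cases r <;> fin_cases s <;> assumption

theorem isPGroup_zpowers_of_pow_eq_one {G : Type*} [Group G] {p n : ℕ} {x : G}
    (hx : x ^ p ^ n = 1) : IsPGroup p (Subgroup.zpowers x) := by
  rintro ⟨_, k, rfl⟩
  refine ⟨n, Subtype.ext ?_⟩
  change (x ^ k) ^ p ^ n = 1
  rw [← zpow_natCast, ← zpow_mul, mul_comm, zpow_mul, zpow_natCast, hx, one_zpow]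

/-- The subgroup generated by `I` and `J` is the quaternion group of order eight. It lies in
`SL 2`, and by the trace condition so does each Sylow `2`-subgroup that contains it: if `g` had
determinant `-1`, then `g`, `gI`, `gJ` and `gIJ` would all have trace zero, whence `g = 0`. -/
theorem exists_sylow_det_eq_one {K : Type*} [Field K] (hc : (2 : K) ≠ 0) (h1 : V1 K) (h2 : V2 K)
    (hK : TraceCondition K) :
    ∃ Q : Sylow 2 (GL (Fin 2) K), ∀ g ∈ Q, (g : Matrix (Fin 2) (Fin 2) K).det = 1 := by
  obtain ⟨a, b, hab⟩ := h1
  let A : Matrix (Fin 2) (Fin 2) K := !![0, -1; 1, 0]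
  let B : Matrix (Fin 2) (Fin 2) K := !![a, b; b, -a]
  have dA : A.det = 1 := by simp [A]
  have dB : B.det = 1 := by
    rw [Matrix.det_fin_two_of]
    linear_combination -hab
  have hAA : A * A = -1 := by simp [A, Matrix.one_fin_two]
  have hBB : B * B = -1 := by
    have h : a * a + b * b = -1 := by linear_combination hab
    have h' : b * b + a * a = -1 := by linear_combination hab
    simp [B, Matrix.one_fin_two, h, h', mul_comm b a]
  have hBA : B * A = -(A * B) := by simp [A, B]
  have unit (C : Matrix (Fin 2) (Fin 2) K) (hC : C * C = -1) : ∃ x : GL (Fin 2) K,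
      (x : Matrix (Fin 2) (Fin 2) K) = C ∧ ((x⁻¹ : GL (Fin 2) K) : Matrix (Fin 2) (Fin 2) K) = -C :=
    ⟨⟨C, -C, by rw [mul_neg, hC, neg_neg], by rw [neg_mul, hC, neg_neg]⟩, rfl, rfl⟩
  have hpow4 {x : GL (Fin 2) K} {C : Matrix (Fin 2) (Fin 2) K} (hx : (x : Matrix _ _ K) = C)
      (hC : C * C = -1) : x ^ 2 ^ 2 = 1 := by
    refine Units.ext ?_
    rw [Units.val_pow_eq_pow_val, hx, show 2 ^ 2 = 2 * 2 from rfl, pow_mul, sq C, hC, neg_one_sq,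
      Units.val_one]
  obtain ⟨I, hI, hI'⟩ := unit A hAA
  obtain ⟨J, hJ, hJ'⟩ := unit B hBB
  have hconj : J * I * J⁻¹ = I⁻¹ := by
    refine Units.ext ?_
    rw [Units.val_mul, Units.val_mul, hI, hJ, hI', hJ', hBA, neg_mul_neg, mul_assoc, hBB,
      mul_neg_one]
  have hnorm : Subgroup.zpowers J ≤ Subgroup.normalizer (Subgroup.zpowers I) := by
    rw [Subgroup.zpowers_le, Subgroup.mem_normalizer_iff_map_conj_eq, MonoidHom.map_zpowers]
    change Subgroup.zpowers (J * I * J⁻¹) = _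
    rw [hconj, Subgroup.zpowers_inv]
  obtain ⟨Q, hQ⟩ := ((isPGroup_zpowers_of_pow_eq_one (hpow4 hJ hBB)).to_sup_of_normal_right'
    (isPGroup_zpowers_of_pow_eq_one (hpow4 hI hAA)) hnorm).exists_le_sylow
  have hIQ : I ∈ Q := hQ (Subgroup.mem_sup_right (Subgroup.mem_zpowers I))
  have hJQ : J ∈ Q := hQ (Subgroup.mem_sup_left (Subgroup.mem_zpowers J))
  refine ⟨Q, fun g hg => ?_⟩
  have hpow {x : GL (Fin 2) K} (hx : x ∈ Q) : ∃ n : ℕ, x ^ 2 ^ n = 1 := by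
    obtain ⟨n, hn⟩ := Q.isPGroup' ⟨x, hx⟩
    exact ⟨n, congrArg Subtype.val hn⟩
  obtain ⟨n, hn⟩ := hpow hg
  have hdet : (g : Matrix (Fin 2) (Fin 2) K).det ^ 2 ^ n = 1 := by
    rw [← Matrix.det_pow, ← Units.val_pow_eq_pow_val, hn, Units.val_one, Matrix.det_one]
  refine (eq_one_or_eq_neg_one_of_pow_two_pow h2 hdet).resolve_right fun hneg => ?_
  have htr {x : GL (Fin 2) K} (hx : x ∈ Q) (hx1 : (x : Matrix (Fin 2) (Fin 2) K).det = 1) :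
      ((g : Matrix (Fin 2) (Fin 2) K) * x).trace = 0 := by
    obtain ⟨m, hm⟩ := hpow (mul_mem hg hx)
    exact hK (g * x) m hm (by rw [Units.val_mul, Matrix.det_mul, hneg, hx1, mul_one])
  have h0 := eq_zero_of_trace_mul_eq_zero hc hab (g : Matrix (Fin 2) (Fin 2) K)
    (by simpa using htr (one_mem Q) (by simp)) 
    (by
      have h := htr hIQ
      rw [hI] at h
      exact h dA)
    (by
      have h := htr hJQ
      rw [hJ] at h
      exact h dB)
    (by
      have h := htr (mul_mem hIQ hJQ)
      rw [Units.val_mul, hI, hJ, Matrix.det_mul, dA, dB] at h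
      exact h (mul_one 1))
  exact g.ne_zero h0

/-- A Sylow `2`-subgroup that contains `diag(1, -1)` is not conjugate to one inside `SL 2`. -/
theorem exists_sylow_not_conj {K : Type*} [Field K] (hc : (2 : K) ≠ 0) (h1 : V1 K) (h2 : V2 K)
    (hK : TraceCondition K) :
    ∃ P Q : Sylow 2 (GL (Fin 2) K), ∀ g : GL (Fin 2) K, g • P ≠ Q := by
  obtain ⟨Q, hQ⟩ := exists_sylow_det_eq_one hc h1 h2 hK
  let D : Matrix (Fin 2) (Fin 2) K := !![1, 0; 0, -1]
  have hD : D * D = 1 := by simp [D, Matrix.one_fin_two]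
  let s : GL (Fin 2) K := ⟨D, D, hD, hD⟩
  have hs : s ^ 2 ^ 1 = 1 := Units.ext (by rw [pow_one, sq]; exact hD)
  have hsP := isPGroup_zpowers_of_pow_eq_one hs
  obtain ⟨P, hP⟩ := hsP.exists_le_sylow
  refine ⟨P, Q, fun g hg => hc ?_⟩
  have hmem : g * s * g⁻¹ ∈ Q := by
    rw [← hg]
    change _ ∈ ((g • P : Sylow 2 (GL (Fin 2) K)) : Subgroup (GL (Fin 2) K))
    rw [Sylow.coe_subgroup_smul]
    exact Subgroup.smul_mem_pointwise_smul s (MulAut.conj g) P (hP (Subgroup.mem_zpowers s))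
  -- `g * s * g⁻¹` has the determinant `-1` of `s`
  have hdet := hQ _ hmem
  rw [Units.val_mul, Units.val_mul, Matrix.det_mul, Matrix.det_mul, mul_right_comm,
    ← Matrix.det_mul, ← Units.val_mul, mul_inv_cancel, Units.val_one, Matrix.det_one, one_mul]
    at hdet
  have : (s : Matrix (Fin 2) (Fin 2) K).det = -1 := by
    change D.det = -1
    simp [D]
  linear_combination hdet.symm.trans this

/-! ### The ultraproduct of the prime fields -/

section UltraField

variable {J : Set Nat.Primes} {U : Ultrafilter J}

theorem eventually_not_dvd (hU : IsNonprincipal U) {n : ℕ} (hn : n ≠ 0) :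
    ∀ᶠ p : J in (U : Filter J), ¬ ((p : Nat.Primes) : ℕ) ∣ n := by
  refine hU.le_cofinite (eventually_cofinite.2 ?_)
  refine ((Set.finite_Iic n).preimage (f := fun p : J => ((p : Nat.Primes) : ℕ))
    fun p _ q _ h => Subtype.ext (Subtype.ext h)).subset fun p hp => ?_
  exact Nat.le_of_dvd (Nat.pos_of_ne_zero hn) (not_not.1 hp)

theorem IsAdmissible.eventually_dvd (hJ : IsAdmissible J) (hU : IsNonprincipal U) (N : ℕ) :
    ∀ᶠ p : J in (U : Filter J), 2 ^ N ∣ ((p : Nat.Primes) : ℕ) + 1 := by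
  refine hU.le_cofinite (eventually_cofinite.2 ?_)
  exact ((hJ.dvd N).preimage Subtype.val_injective.injOn).subset fun p hp => ⟨p.2, hp⟩

theorem charZero_ultraField (hU : IsNonprincipal U) : CharZero (ultraField J U) := by
  refine charZero_of_inj_zero fun n hn => ?_
  by_contra hn0
  rw [← map_natCast (mkHom U fun p : J => ZMod ((p : Nat.Primes) : ℕ))] at hn
  obtain ⟨p, hp, hp'⟩ := ((mk_eq_mk.1 hn).and (eventually_not_dvd hU hn0)).exists
  exact hp' ((ZMod.natCast_eq_zero_iff _ _).1 hp)

theorem isPseudofiniteField_ultraField (hU : IsNonprincipal U) :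
    IsPseudofiniteField (ultraField J U) := by
  have := charZero_ultraField hU
  exact ⟨CharZero.infinite _, fun φ hφ =>
    (fieldSatisfies_ultraproduct φ).2 (.of_forall fun p => hφ _)⟩

theorem v1_ultraField : V1 (ultraField J U) := by
  choose a b hab using fun p : J => ZMod.sq_add_sq ((p : Nat.Primes) : ℕ) (-1)
  refine ⟨mk U a, mk U b, ?_⟩
  simp only [sq] at hab ⊢
  exact mk_eq_mk.2 (.of_forall hab)

theorem IsAdmissible.v2_ultraField (hJ : IsAdmissible J) : V2 (ultraField J U) := by
  intro x hx
  -- an element of order four is a square root of `-1`, and there is none in `𝔽_p` for `p ≡ 3 mod 4`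
  have h4 : (x ^ 2) ^ 2 = 1 := by rw [← pow_mul, ← pow_orderOf_eq_one x, hx]
  have h2 : x ^ 2 ≠ 1 := fun h => by
    have := Nat.le_of_dvd two_pos (orderOf_dvd_of_pow_eq_one h)
    omega
  have h := (sq_eq_one_iff.1 h4).resolve_left h2
  obtain ⟨x, rfl⟩ := mk_surjective x
  rw [sq] at h
  obtain ⟨p, hp⟩ := (mk_eq_mk (x := fun p => x p * x p) (y := fun _ => -1).1 h).exists
  exact ZMod.exists_sq_eq_neg_one_iff.1 ⟨x p, hp.symm⟩ (hJ.mod_four p p.2)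

theorem IsAdmissible.traceCondition_ultraField (hJ : IsAdmissible J) (hU : IsNonprincipal U) :
    TraceCondition (ultraField J U) := by
  intro g n hg hdet
  obtain ⟨x, rfl⟩ := glMk_surjective g
  rw [← map_pow, ← map_one (glMk U _ (Fin 2)), glMk_eq_iff] at hg
  rw [det_glMk] at hdet
  rw [trace_glMk]
  refine mk_eq_mk.2 ?_
  filter_upwards [hg, mk_eq_mk.1 hdet, hJ.eventually_dvd hU n] with p hp hpdet hdvd
  refine trace_eq_zero_of_pow_succ_eq_one ?_ ?_ hpdet
  · intro h2
    have := hJ.mod_four p p.2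
    omega
  · obtain ⟨k, hk⟩ := hdvd
    have hxp : x p ^ 2 ^ n = 1 := hp
    rw [← Units.val_pow_eq_pow_val, hk, pow_mul, hxp, one_pow, Units.val_one]

theorem isPseudofiniteGroup_gl_ultraField (hU : IsNonprincipal U) :
    IsPseudofiniteGroup (GL (Fin 2) (ultraField J U)) := by
  have := charZero_ultraField hU
  refine ⟨?_, fun φ hφ => ?_⟩
  · exact Infinite.of_injective
      (fun t : ultraField J U => Matrix.GeneralLinearGroup.upperRightHom t)
      Matrix.GeneralLinearGroup.injective_upperRightHom
  · refine (groupSatisfies_congr (glUltraproductEquiv U _ (Fin 2)) φ).1 ?_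
    exact (groupSatisfies_ultraproduct φ).2 (.of_forall fun p => hφ _)

theorem isLinearGroup_gl (n : ℕ) (K : Type) [Field K] : IsLinearGroup (GL (Fin n) K) :=
  ⟨n, K, inferInstance, ⊤, ⟨Subgroup.topEquiv.symm⟩⟩

theorem IsAdmissible.exists_sylow_not_conj (hJ : IsAdmissible J) (hU : IsNonprincipal U) :
    ∃ P Q : Sylow 2 (GL (Fin 2) (ultraField J U)),
      ∀ g : GL (Fin 2) (ultraField J U), g • P ≠ Q :=
  have := charZero_ultraField hU
  SylowUltra.exists_sylow_not_conj two_ne_zero v1_ultraField hJ.v2_ultraField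
    (hJ.traceCondition_ultraField hU)

end UltraField

theorem not_closedUnderUltraproducts_hasConjugateSylows :
    ¬ ClosedUnderUltraproducts HasConjugateSylows := by
  intro h
  obtain ⟨J, hJ⟩ := exists_isAdmissible
  have : Infinite J := hJ.infinite.to_subtype
  obtain ⟨U, hU⟩ := exists_isNonprincipal J
  obtain ⟨P, Q, hPQ⟩ := hJ.exists_sylow_not_conj hU
  have hGL := (h J U (fun p => GL (Fin 2) (ZMod ((p : Nat.Primes) : ℕ)))
    fun p => hasConjugateSylows_of_finite _).of_mulEquiv (glUltraproductEquiv U _ (Fin 2))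
  obtain ⟨g, hg⟩ := hGL 2 Nat.prime_two P Q
  exact hPQ g hg

end SylowUltra

end

theorem mainTheorem4 :
    (∀ N : ℕ, {p : Nat.Primes | (p : ℕ) % 4 = 3 ∧ 2 ^ N ∣ (p : ℕ) + 1}.Infinite) ∧
    (∃ J : Set Nat.Primes, SylowUltra.IsAdmissible J) ∧
    (∀ J : Set Nat.Primes, SylowUltra.IsAdmissible J →
      ∀ U : Ultrafilter J, SylowUltra.IsNonprincipal U →
        SylowUltra.IsPseudofiniteField (SylowUltra.ultraField J U) ∧
        SylowUltra.V1 (SylowUltra.ultraField J U) ∧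
        SylowUltra.V2 (SylowUltra.ultraField J U) ∧
        SylowUltra.V3 (SylowUltra.ultraField J U) ∧
        SylowUltra.IsLinearGroup (GL (Fin 2) (SylowUltra.ultraField J U)) ∧
        SylowUltra.IsPseudofiniteGroup (GL (Fin 2) (SylowUltra.ultraField J U)) ∧
        ∃ P Q : Sylow 2 (GL (Fin 2) (SylowUltra.ultraField J U)),
          ∀ g : GL (Fin 2) (SylowUltra.ultraField J U), g • P ≠ Q) ∧
    ¬ SylowUltra.ClosedUnderUltraproducts SylowUltra.HasConjugateSylows ∧
    ¬ SylowUltra.IsElementaryClass SylowUltra.HasConjugateSylows := by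
  refine ⟨SylowUltra.infinite_primes_dvd_add_one, SylowUltra.exists_isAdmissible,
    fun J hJ U hU => ?_, SylowUltra.not_closedUnderUltraproducts_hasConjugateSylows,
    fun h => SylowUltra.not_closedUnderUltraproducts_hasConjugateSylows h.closedUnderUltraproducts⟩
  have := SylowUltra.charZero_ultraField hU
  exact ⟨SylowUltra.isPseudofiniteField_ultraField hU, SylowUltra.v1_ultraField, hJ.v2_ultraField,
    (hJ.traceCondition_ultraField hU).v3 two_ne_zero hJ.v2_ultraField,
    SylowUltra.isLinearGroup_gl 2 _, SylowUltra.isPseudofiniteGroup_gl_ultraField hU,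
    hJ.exists_sylow_not_conj hU⟩
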